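/- Let $X=(X(t))_{t\in[0,1]}$ be a centered, (jointly) measurable second-order process with trajectories a.s. in $L^2[0,1]$, whose covariance function $K(t,s)=\mathbb E[X(t)X(s)]$ is continuous and strictly positive definite (i.e. $\sum_{i,j}a_ia_jK(t_i,t_j)>0$ for distinct $t_i$ and $(a_i)\neq 0$). For $p\in\mathbb N=\{1,2,\dots\}$ let $\Theta_p=\mathbb R^p\times[0,1]^p\times\mathbb R\times[0,\infty)$, with elements $\theta=(\beta_1,\dots,\beta_p,t_1,\dots,t_p,\alpha_0,\sigma^2)$, and let $\Theta=\bigcup_{p\ge 1}\Theta_p$ (disjoint union), writing $p(\theta)$ for the $p$ with $\theta\in\Theta_p$. Equip $\Theta$ with the metric $d(\theta,\theta')=\min\{\|\theta-\theta'\|,1\}$ (Euclidean norm) if $p(\theta)=p(\theta')$ and $d(\theta,\theta')=1$ otherwise, and with its Borel $\sigma$-algebra. For $\theta\in\Theta$ let $P_\theta$ be the distribution on $L^2[0,1]\times\mathbb R$ of $(X,Y)$, where $Y\mid X\sim\mathcal N\big(\alpha_0+\sum_{j=1}^{p(\theta)}\beta_jX(t_j),\sigma^2\big)$. Let $\pi$,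 $F_p$, $G_p$, $C$, $D$ be probability measures on $\mathbb N$, $\mathbb R^p$, $[0,1]^p$, $\mathbb R$, $[0,\infty)$, and let $\Pi$ be the prior distribution on $\Theta$ of the random parameter $\boldsymbol\theta$ obtained by drawing $\mathcal P\sim\pi$ and, given $\mathcal P=p$, independently $(\beta_j)_{j\le p}\sim F_p$, $(t_j)_{j\le p}\sim G_p$, $\alpha_0\sim C$, $\sigma^2\sim D$. Given $\boldsymbol\theta$, let the data $(X_1,Y_1),(X_2,Y_2),\dots$ be i.i.d. with law $P_{\boldsymbol\theta}$, and let $\Pi(\,\cdot\mid (X,Y)_{1:n})$ be (any fixed version of) the posterior distribution, i.e. the regular conditional distribution of $\boldsymbol\theta$ given $(X_1,Y_1),\dots,(X_n,Y_n)$ in this joint model. Suppose that for every $p\in\mathbb N$ with $\pi(p)>0$: (i) $\Pi(t_i=t_j\mid\mathcal P=p)=0$ for all $1\le i<j\le p$; (ii) there is $\delta>0$ such that $\Pi(|\beta_j|<\delta\mid\mathcal P=p)=0$ for all $1\le j\le p$. For a permutation $\nu$ of $\{1,\dots,p\}$ and $\theta\in\Theta_p$ let $\theta[\nu]=(\beta_{\nu_1},\dots,\beta_{\nu_p},t_{\nu_1},\dots,t_{\nu_p},\alpha_0,\sigma^2)$,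 and for $\varepsilon>0$ and $\theta_0\in\Theta$ let $\tilde B(\theta_0,\varepsilon)=\bigcup_{\nu\in S_{p(\theta_0)}}\{\theta\in\Theta: d(\theta,\theta_0[\nu])<\varepsilon\}$. Then there exists a measurable set $\Theta_*\subseteq\Theta$ with $\Pi(\Theta_*)=1$ such that for every $\theta_0\in\Theta_*$, if $(X_1,Y_1),(X_2,Y_2),\dots$ are i.i.d. with law $P_{\theta_0}$, then for every $\varepsilon>0$ $$\lim_{n\to\infty}\Pi\big(\boldsymbol\theta\in\tilde B(\theta_0,\varepsilon)\mid (X,Y)_{1:n}\big)=1\quad\text{almost surely},$$ and $$\lim_{n\to\infty}\Pi\big(\mathcal P=p(\theta_0)\mid (X,Y)_{1:n}\big)=1\quad\text{almost surely}.$$ -/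

import Mathlib

open MeasureTheory ProbabilityTheory Filter Topology
open scoped NNReal ENNReal

namespace FunctionalRegression

noncomputable section

/-! ### The sample space -/

/-- The space `L²[0,1]` of (classes of) square-integrable trajectories. -/
abbrev Curve : Type := Lp ℝ 2 (volume : Measure unitInterval)

instance instMeasurableSpaceCurve : MeasurableSpace Curve := borel Curve

instance instBorelSpaceCurve : BorelSpace Curve := ⟨rfl⟩

/-- The sample space `L²[0,1] × ℝ` of the pairs `(X, Y)`. -/
abbrev Obs : Type := Curve × ℝ

/-! ### The parameter space -/

/-- `Θ_p`, the parameters `(b, τ, α₀, σ²)` with `p` components: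
`ℝ^p × [0,1]^p × ℝ × [0,∞)`. -/
abbrev ParamOf (p : ℕ+) : Type :=
  (Fin (p : ℕ) → ℝ) × (Fin (p : ℕ) → unitInterval) × ℝ × ℝ≥0

/-- `Θ`, the disjoint union of the `Θ_p`, `p = 1, 2, …`, with the disjoint-union
σ-algebra. The number of components of `θ` is `θ.1`. -/
abbrev Param : Type := Σ p : ℕ+, ParamOf p

namespace ParamOf

variable {p : ℕ+}

/-- The coefficients `β_j`. -/
def coef (x : ParamOf p) : Fin (p : ℕ) → ℝ := x.1

/-- The times `t_j`. -/
def time (x : ParamOf p) : Fin (p : ℕ) → unitInterval := x.2.1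

/-- The intercept `α₀`. -/
def intercept (x : ParamOf p) : ℝ := x.2.2.1

/-- The error variance `σ²`. -/
def errVar (x : ParamOf p) : ℝ≥0 := x.2.2.2

/-- The Euclidean distance of `ℝ^(2p+2)` on `Θ_p`. -/
def euclDist (x y : ParamOf p) : ℝ :=
  Real.sqrt ((∑ j, (coef x j - coef y j) ^ 2)
    + (∑ j, ((time x j : ℝ) - (time y j : ℝ)) ^ 2)
    + (intercept x - intercept y) ^ 2 + ((errVar x : ℝ) - (errVar y : ℝ)) ^ 2)

/-- Relabelling of the components: `x[ν]`. -/
def relabel (x : ParamOf p) (ν : Equiv.Perm (Fin (p : ℕ))) : ParamOf p :=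
  (fun j => coef x (ν j), fun j => time x (ν j), intercept x, errVar x)

end ParamOf

/-- The metric of `Θ`: the Euclidean distance truncated at `1` inside each `Θ_p`, and `1`
between parameters with different numbers of components. -/
def paramDist (θ θ' : Param) : ℝ :=
  if h : θ'.1 = θ.1 then min (ParamOf.euclDist θ.2 (h ▸ θ'.2)) 1 else 1

/-- The set of all parameters within `ε` of some relabelling of `θ₀`. -/
def permBall (θ₀ : Param) (ε : ℝ) : Set Param :=
  ⋃ ν : Equiv.Perm (Fin (θ₀.1 : ℕ)), {θ | paramDist θ ⟨θ₀.1, θ₀.2.relabel ν⟩ < ε}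

/-- The event that the number of components is `p`. -/
def numComp (p : ℕ+) : Set Param := {θ | θ.1 = p}

/-! ### The covariate process -/

section Covariate

variable {Ω : Type*} [MeasurableSpace Ω]

/-- The covariance function `K(t,s) = E[X(t) X(s)]` of a centered process. -/
def covFun (μ : Measure Ω) (X : unitInterval → Ω → ℝ) (t s : unitInterval) : ℝ :=
  ∫ ω, X t ω * X s ω ∂μ

/-- `X` is a (jointly measurable) centered second-order process on `[0,1]` with trajectories in
`L²[0,1]` whose covariance function is continuous and strictly positive definite. -/
structure IsCovariateProcess (μ : Measure Ω) (X : unitInterval → Ω → ℝ) : Prop where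
  measurable : Measurable (Function.uncurry X)
  secondOrder : ∀ t, MemLp (X t) 2 μ
  centered : ∀ t, ∫ ω, X t ω ∂μ = 0
  trajectory : ∀ᵐ ω ∂μ, MemLp (fun t => X t ω) 2 (volume : Measure unitInterval)
  cov_continuous : Continuous (Function.uncurry (covFun μ X))
  cov_strictPosDef : ∀ (m : ℕ) (t : Fin m → unitInterval), Function.Injective t →
    ∀ a : Fin m → ℝ, a ≠ 0 → 0 < ∑ i, ∑ j, a i * a j * covFun μ X (t i) (t j)

open Classical in
/-- The trajectory of `X` at `ω` as an element of `L²[0,1]` (and `0` where the trajectory is not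
square-integrable). -/
def trajectory (X : unitInterval → Ω → ℝ) (ω : Ω) : Curve :=
  if h : MemLp (fun t => X t ω) 2 (volume : Measure unitInterval) then h.toLp _ else 0

/-- The regression function `α₀ + ∑ⱼ βⱼ X(tⱼ)`. -/
def regMean (X : unitInterval → Ω → ℝ) (θ : Param) (ω : Ω) : ℝ :=
  θ.2.intercept + ∑ j, θ.2.coef j * X (θ.2.time j) ω

/-- The data distribution `P_θ(X,Y)` on `L²[0,1] × ℝ`: the law of `(X, Y)` with
`Y = α₀ + ∑ⱼ βⱼ X(tⱼ) + e`, where `e ∼ N(0,σ²)` is independent of `X`. -/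
def dataLaw (μ : Measure Ω) (X : unitInterval → Ω → ℝ) (θ : Param) : Measure Obs :=
  (μ.prod (gaussianReal 0 θ.2.errVar)).map
    fun q : Ω × ℝ => (trajectory X q.1, regMean X θ q.1 + q.2)

end Covariate

/-! ### Prior and posterior -/

/-- The prior distribution of `θ` in the hierarchical model: the number of components is drawn
from `π`; given that it is `p`, the coefficients, times, intercept and error variance are drawn
independently from `F p`, `G p`, `C` and `D`. -/
def prior (π : PMF ℕ+) (F : ∀ p : ℕ+, Measure (Fin (p : ℕ) → ℝ))
    (G : ∀ p : ℕ+, Measure (Fin (p : ℕ) → unitInterval)) (C : Measure ℝ) (D : Measure ℝ≥0) :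
    Measure Param :=
  Measure.sum fun p : ℕ+ =>
    π p • (((F p).prod ((G p).prod (C.prod D))).map (Sigma.mk p) : Measure Param)

/-- The identifiability constraints on the prior. Conditioning on an event of probability zero
is void (`ProbabilityTheory.cond` is then the zero measure). -/
def Identifiability (prr : Measure Param) : Prop :=
  ∀ p : ℕ+,
    (∀ i j : Fin (p : ℕ), i < j →
      cond prr (numComp p) {θ | ∃ x : ParamOf p, θ = ⟨p, x⟩ ∧ x.time i = x.time j} = 0) ∧
    ∃ δ : ℝ, 0 < δ ∧ ∀ j : Fin (p : ℕ),
      cond prr (numComp p) {θ | ∃ x : ParamOf p, θ = ⟨p, x⟩ ∧ |x.coef j| < δ} = 0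

/-- The joint law of the parameter and of `n` observations that are, given `θ`, i.i.d. with
law `P θ`. -/
def jointLaw (prr : Measure Param) (P : Param → Measure Obs) (n : ℕ) :
    Measure (Param × (Fin n → Obs)) :=
  prr.bind fun θ => (Measure.dirac θ).prod (Measure.pi fun _ : Fin n => P θ)

/-- `Q` is (a version of) the posterior distribution given `n` observations: a regular conditional
distribution of the parameter given the observations under their joint law. -/
def IsPosterior (prr : Measure Param) (P : Param → Measure Obs) (n : ℕ)
    (Q : Kernel (Fin n → Obs) Param) : Prop :=
  IsMarkovKernel Q ∧
    ∀ (A : Set (Fin n → Obs)) (B : Set Param), MeasurableSet A → MeasurableSet B →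
      jointLaw prr P n (B ×ˢ A) = ∫⁻ z in A, Q z B ∂(jointLaw prr P n).snd

end

end FunctionalRegression

/-!
The argument is Doob's consistency theorem, combined with identification of the parameter up to
relabelling.

*Consistency.* The data are generated as `Z i = observe (θ, w i)` from an i.i.d. noise sequence `w`,
so that parameter and infinite sample live on one product space, and on it the posterior
probability of a set `B` after `n` observations is the conditional expectation of `1_B(θ)` given
`Z 0, …, Z (n-1)`. By Lévy's upward theorem it converges almost surely to the conditional
expectation given the whole sample, which is `1_B(θ)` itself as soon as the event `θ ∈ B` can be
read off the infinite sample (`ae_tendsto_posterior`).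

*Reading off the parameter.* The sample determines, by the strong law of large numbers, the
probabilities under `P_θ` of the countably many cells of a Borel embedding of `Obs` in `ℝ`, hence
`P_θ` (`ae_freq_eq`, `measure_eq_of_cell`). On the parameters with increasing times and non-zero
coefficients `θ ↦ P_θ` is injective (`IsCovariateProcess.injOn_dataLaw`), so the Lusin–Souslin
theorem makes the images of Borel sets of such parameters Borel
(`measurableSet_image_cellProb`). Every parameter with distinct times and non-zero coefficients,
that is, almost every one, has such a relabelling, with the same data law; therefore every
permutation invariant Borel set can be read off the sample (`cellProb_mem_image_iff`).

*Injectivity.* Three moments of `P_θ` suffice. The mean of `Y` is the intercept. For `g` continuous,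
`E[Y ⟨X, g⟩] = ∫ (∑ⱼ βⱼ K(tⱼ, s)) g(s) ds`, which determines the continuous function
`∑ⱼ βⱼ K(tⱼ, ·)` and, `K` being strictly positive definite, the discrete measure `∑ⱼ βⱼ δ_{tⱼ}`.
Finally `E[Y²]` gives the error variance.

*One set of full measure.* The exceptional set of parameters depends on `B`. Letting `B` run through
the symmetrizations of a countable basis of each `Θ_p` takes care of all permutation balls at once
(`exists_symmetrize_subset_permBall`), and a ball of radius at most `1` fixes the number of
components.
-/

namespace FunctionalRegression

noncomputable section

/-! ### Doob's theorem for a fixed set of parameters -/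

section Doob

variable {W : Type*} [MeasurableSpace W] {ν : Measure W} [IsProbabilityMeasure ν]
  {f : Param × W → Obs} {P : Param → Measure Obs}

/-- An infinite i.i.d. sample from `P θ` is the image of an i.i.d. sequence of noise variables. -/
theorem infinitePi_eq_map (hf : Measurable f)
    (hP : ∀ θ, P θ = ν.map fun w => f (θ, w)) (θ : Param) :
    Measure.infinitePi (fun _ : ℕ => P θ) =
      (Measure.infinitePi fun _ : ℕ => ν).map fun w i => f (θ, w i) := by
  have h := Measure.infinitePi_map_pi (X := fun _ : ℕ => W) (Y := fun _ : ℕ => Obs)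
    (μ := fun _ => ν) (f := fun _ w => f (θ, w)) (fun _ => hf.comp measurable_prodMk_left)
  rw [h]
  simp_rw [hP]

theorem pi_eq_map (hf : Measurable f)
    (hP : ∀ θ, P θ = ν.map fun w => f (θ, w)) (θ : Param) (n : ℕ) :
    Measure.pi (fun _ : Fin n => P θ) =
      (Measure.infinitePi fun _ : ℕ => ν).map fun w (i : Fin n) => f (θ, w i) := by
  have hm : Measurable fun w => f (θ, w) := hf.comp measurable_prodMk_left
  have h := (iIndepFun_infinitePi (P := fun _ : ℕ => ν) (X := fun _ w => f (θ, w))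
    (fun _ => hm)).precomp (g := fun i : Fin n => (i : ℕ)) Fin.val_injective
  have hm' : ∀ i : Fin n, Measurable fun w : ℕ → W => f (θ, w i) :=
    fun i => hm.comp (measurable_pi_apply (i : ℕ))
  rw [iIndepFun_iff_map_fun_eq_pi_map fun i => (hm' i).aemeasurable] at h
  rw [h]
  congr 1
  ext1 i
  conv_lhs => rw [hP, ← Measure.infinitePi_map_eval (fun _ : ℕ => ν) (i : ℕ),
    Measure.map_map hm (by fun_prop)]
  rfl

/-- The joint laws for all sample sizes are realized on one space, the product of the prior with
an i.i.d. sequence of noise variables. In particular the kernel in the definition of `jointLaw`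
is measurable, so that `Measure.bind` does not take its junk value there. -/
theorem jointLaw_eq_map {prr : Measure Param} [SFinite prr] (hf : Measurable f)
    (hP : ∀ θ, P θ = ν.map fun w => f (θ, w)) (n : ℕ) :
    jointLaw prr P n = (prr.prod (Measure.infinitePi fun _ : ℕ => ν)).map
      fun x => (x.1, fun i : Fin n => f (x.1, x.2 i)) := by
  have hm : Measurable fun x : Param × (ℕ → W) => (x.1, fun i : Fin n => f (x.1, x.2 i)) := by
    fun_prop
  have hk : ∀ θ, (Measure.dirac θ).prod (Measure.pi fun _ : Fin n => P θ) =
      (Measure.infinitePi fun _ : ℕ => ν).map fun w => (θ, fun i : Fin n => f (θ, w i)) := by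
    intro θ
    rw [pi_eq_map hf hP, Measure.dirac_prod, Measure.map_map (by fun_prop) (by fun_prop)]
    rfl
  have hk' : ∀ θ s, MeasurableSet s →
      (Measure.dirac θ).prod (Measure.pi fun _ : Fin n => P θ) s =
      (Measure.infinitePi fun _ : ℕ => ν) (Prod.mk θ ⁻¹'
        ((fun x : Param × (ℕ → W) => (x.1, fun i : Fin n => f (x.1, x.2 i))) ⁻¹' s)) := by
    intro θ s hs
    rw [hk, Measure.map_apply (by fun_prop) hs]
    rfl
  ext s hs
  rw [jointLaw, Measure.bind_apply hs, Measure.map_apply hm hs, Measure.prod_apply (hm hs)]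
  · simp_rw [hk' _ s hs]
  · refine (Measure.measurable_of_measurable_coe _ fun s hs => ?_).aemeasurable
    simp_rw [hk' _ s hs]
    exact measurable_measure_prodMk_left (hm hs)

/-- **Lévy's upward theorem for posteriors.** If membership of the parameter in `B` can be read
off the whole infinite sample, then the posterior probability of `B` tends to `1` under
almost every parameter in `B`. -/
theorem ae_tendsto_posterior {prr : Measure Param} [IsProbabilityMeasure prr] (hf : Measurable f)
    (hP : ∀ θ, P θ = ν.map fun w => f (θ, w))
    {Q : ∀ n : ℕ, Kernel (Fin n → Obs) Param} (hQ : ∀ n, IsPosterior prr P n (Q n))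
    {B : Set Param} (hB : MeasurableSet B) {S : Set (ℕ → Obs)} (hS : MeasurableSet S)
    (hBS : ∀ᵐ θ ∂prr, ∀ᵐ z ∂Measure.infinitePi (fun _ : ℕ => P θ), z ∈ S ↔ θ ∈ B) :
    ∀ᵐ θ ∂prr, θ ∈ B → ∀ᵐ z ∂Measure.infinitePi (fun _ : ℕ => P θ),
      Tendsto (fun n : ℕ => Q n (fun i : Fin n => z i) B) atTop (𝓝 1) := by
  have : ∀ n, IsMarkovKernel (Q n) := fun n => (hQ n).1
  set J := prr.prod (Measure.infinitePi fun _ : ℕ => ν)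
  let Z : Param × (ℕ → W) → ℕ → Obs := fun x i => f (x.1, x.2 i)
  have hZ : Measurable Z := by fun_prop
  have hZθ : ∀ θ, Measurable fun (w : ℕ → W) i => f (θ, w i) :=
    fun θ => hZ.comp measurable_prodMk_left
  let Zn : ∀ n : ℕ, Param × (ℕ → W) → Fin n → Obs := fun n x i => f (x.1, x.2 i)
  have hZn : ∀ n, Measurable (Zn n) := fun n => by fun_prop
  let ℱ : Filtration ℕ (inferInstance : MeasurableSpace (Param × (ℕ → W))) :=
    { seq := fun n => MeasurableSpace.comap (Zn n) inferInstance
      mono' := by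
        intro m n hmn
        rw [← measurable_iff_comap_le]
        have : Zn m = (fun z i => z (Fin.castLE hmn i)) ∘ Zn n := rfl
        rw [this]
        exact (measurable_pi_lambda _ fun i => measurable_pi_apply _).comp
          (comap_measurable (Zn n))
      le' := fun n => (hZn n).comap_le }
  have hQm : ∀ n, Measurable fun z => Q n z B := fun n => Kernel.measurable_coe _ hB
  let g : Param × (ℕ → W) → ℝ := (Prod.fst ⁻¹' B).indicator 1
  have hBm : MeasurableSet (Prod.fst ⁻¹' B : Set (Param × (ℕ → W))) := measurable_fst hB
  have hg : Integrable g J := (integrable_const (1 : ℝ)).indicator hBm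
  -- the posterior probability is the conditional expectation of the indicator
  have hcond : ∀ n, (fun x => (Q n (Zn n x) B).toReal) =ᵐ[J] J[g | ℱ n] := by
    intro n
    have hbdd : Integrable (fun x => (Q n (Zn n x) B).toReal) J := by
      refine Integrable.of_bound (((hQm n).comp (hZn n)).ennreal_toReal.aestronglyMeasurable) 1
        (ae_of_all _ fun x => ?_)
      rw [Real.norm_of_nonneg ENNReal.toReal_nonneg]
      exact ENNReal.toReal_mono ENNReal.one_ne_top prob_le_one
    refine ae_eq_condExp_of_forall_setIntegral_eq (ℱ.le n) hg
      (fun s _ _ => hbdd.integrableOn) ?_ ?_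
    · rintro s ⟨A, hA, rfl⟩ -
      have h1 := (hQ n).2 A B hA hB
      have hsnd : (jointLaw prr P n).snd = J.map (Zn n) := by
        rw [jointLaw_eq_map hf hP, Measure.snd, Measure.map_map measurable_snd (by fun_prop)]
        rfl
      rw [hsnd, setLIntegral_map hA (hQm n) (hZn n), jointLaw_eq_map hf hP,
        Measure.map_apply (by fun_prop) (hB.prod hA)] at h1
      have h2 := integral_toReal (μ := J.restrict (Zn n ⁻¹' A))
        (f := fun x => Q n (Zn n x) B) ((hQm n).comp (hZn n)).aemeasurable
        (ae_of_all _ fun x => measure_lt_top _ _)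
      rw [h2, ← h1, integral_indicator_one hBm,
        measureReal_restrict_apply hBm]
      rfl
    · refine StronglyMeasurable.aestronglyMeasurable ?_
      exact (((hQm n).comp (comap_measurable (Zn n))).ennreal_toReal).stronglyMeasurable
  -- the indicator is measurable with respect to the whole sample
  have hBS' : ∀ᵐ x ∂J, Z x ∈ S ↔ x.1 ∈ B := by
    have hm : MeasurableSet {x : Param × (ℕ → W) | Z x ∈ S ↔ x.1 ∈ B} :=
      (hZ hS).iff hBm
    refine (Measure.ae_prod_iff_ae_ae hm).2 ?_
    filter_upwards [hBS] with θ hθ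
    rw [infinitePi_eq_map hf hP] at hθ
    exact ae_of_ae_map (hZθ θ).aemeasurable hθ
  have hZi : Measurable[⨆ n, ℱ n] Z := by
    refine @measurable_pi_lambda _ _ _ (⨆ n, ℱ n) _ _ fun i => ?_
    have h1 : Measurable[ℱ (i + 1)] fun x => Z x i :=
      (measurable_pi_apply (X := fun _ : Fin (i + 1) => Obs) (Fin.last i)).comp
        (comap_measurable (Zn (i + 1)))
    exact h1.mono (le_iSup (fun n => (ℱ n : MeasurableSpace _)) (i + 1)) le_rfl
  have hlim : J[g | ⨆ n, ℱ n] =ᵐ[J] g := by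
    have hle : ⨆ n, (ℱ n : MeasurableSpace _) ≤
        (inferInstance : MeasurableSpace (Param × (ℕ → W))) := iSup_le fun n => ℱ.le n
    have hgS : g =ᵐ[J] (Z ⁻¹' S).indicator 1 := by
      filter_upwards [hBS'] with x hx
      by_cases h : x.1 ∈ B
      · have h2 : x ∈ Z ⁻¹' S := hx.2 h
        have h3 : x ∈ (Prod.fst ⁻¹' B : Set (Param × (ℕ → W))) := h
        simp [g, h2, h3]
      · have h2 : x ∉ Z ⁻¹' S := fun h' => h (hx.1 h')
        have h3 : x ∉ (Prod.fst ⁻¹' B : Set (Param × (ℕ → W))) := h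
        simp [g, h2, h3]
    have hgm : AEStronglyMeasurable[⨆ n, ℱ n] g J := by
      refine ⟨(Z ⁻¹' S).indicator 1, ?_, hgS⟩
      exact (@stronglyMeasurable_const _ _ (⨆ n, ℱ n) _ 1).indicator (hZi hS)
    exact condExp_of_aestronglyMeasurable' hle hgm hg
  have hmain : ∀ᵐ x ∂J, x.1 ∈ B → Tendsto (fun n => Q n (Zn n x) B) atTop (𝓝 1) := by
    filter_upwards [tendsto_ae_condExp (ℱ := ℱ) (μ := J) g, hlim, ae_all_iff.2 hcond]
      with x hx hl hc hxB
    have hg1 : g x = 1 := Set.indicator_of_mem (s := Prod.fst ⁻¹' B) hxB _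
    rw [hl, hg1] at hx
    have h2 : Tendsto (fun n => (Q n (Zn n x) B).toReal) atTop (𝓝 1) := by
      simpa only [hc] using hx
    rw [← ENNReal.toReal_one] at h2
    exact (ENNReal.tendsto_toReal_iff (fun n => measure_ne_top _ _) ENNReal.one_ne_top).1 h2
  have hmain' := Measure.ae_ae_of_ae_prod hmain
  filter_upwards [hmain'] with θ hθ hθB
  rw [infinitePi_eq_map hf hP]
  have hm : MeasurableSet {z : ℕ → Obs |
      Tendsto (fun n : ℕ => Q n (fun i : Fin n => z i) B) atTop (𝓝 1)} :=
    measurableSet_tendsto (𝓝 1) fun n => (hQm n).comp (by fun_prop)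
  rw [ae_map_iff (hZθ θ).aemeasurable hm]
  filter_upwards [hθ] with w hw
  exact hw hθB

end Doob

/-! ### The data law as a function of the infinite sample -/

section Separation

instance : SecondCountableTopology Curve :=
  have : Fact ((2 : ℝ≥0∞) ≠ ∞) := ⟨ENNReal.ofNat_ne_top⟩
  inferInstance

/-- The preimage of `(-∞, q]` under a fixed Borel embedding of the sample space in `ℝ`. The cells
with `q` rational are countably many sets that determine a probability measure. -/
def cell (q : ℚ) : Set Obs := embeddingReal Obs ⁻¹' Set.Iic (q : ℝ)

theorem measurableSet_cell (q : ℚ) : MeasurableSet (cell q) :=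
  (measurableEmbedding_embeddingReal Obs).measurable measurableSet_Iic

theorem measure_eq_of_cell {P P' : Measure Obs} [IsProbabilityMeasure P] [IsProbabilityMeasure P']
    (h : ∀ q, P.real (cell q) = P'.real (cell q)) : P = P' := by
  have he := measurableEmbedding_embeddingReal Obs
  have : IsProbabilityMeasure (P.map (embeddingReal Obs)) :=
    Measure.isProbabilityMeasure_map he.measurable.aemeasurable
  have hmap : P.map (embeddingReal Obs) = P'.map (embeddingReal Obs) := by
    refine ext_of_generate_finite _ (BorelSpace.measurable_eq.trans Real.borel_eq_generateFrom_Iic_rat)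
      Real.isPiSystem_Iic_rat ?_ ?_
    · intro s hs
      simp only [Set.mem_iUnion, Set.mem_singleton_iff] at hs
      obtain ⟨q, rfl⟩ := hs
      rw [he.map_apply, he.map_apply]
      exact (measureReal_eq_measureReal_iff).1 (h q)
    · rw [he.map_apply, he.map_apply]
      simp
  rw [← he.comap_map P, hmap, he.comap_map]

/-- The limiting empirical frequencies of the cells in an infinite sample. The upper limit makes
this a measurable function on all samples; it is used only where the frequencies converge. -/
def freq (z : ℕ → Obs) (q : ℚ) : ℝ :=
  limsup (fun n : ℕ => (∑ i ∈ Finset.range n, (cell q).indicator (fun _ => (1 : ℝ)) (z i)) / n) atTop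

theorem measurable_freq : Measurable freq := by
  refine measurable_pi_lambda _ fun q => Measurable.limsup fun n => ?_
  refine Measurable.div_const (Finset.measurable_sum _ fun i _ => ?_) _
  exact (measurable_const.indicator (measurableSet_cell q)).comp (measurable_pi_apply i)

/-- The strong law of large numbers for the cells. -/
theorem ae_freq_eq (P : Measure Obs) [IsProbabilityMeasure P] :
    ∀ᵐ z ∂Measure.infinitePi (fun _ : ℕ => P), freq z = fun q => P.real (cell q) := by
  have h : ∀ q, ∀ᵐ z ∂Measure.infinitePi (fun _ : ℕ => P), freq z q = P.real (cell q) := by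
    intro q
    have hm : Measurable ((cell q).indicator fun _ => (1 : ℝ)) :=
      measurable_const.indicator (measurableSet_cell q)
    have hmap : ∀ i : ℕ, (Measure.infinitePi fun _ : ℕ => P).map (fun z => z i) = P :=
      fun i => Measure.infinitePi_map_eval (fun _ : ℕ => P) i
    have hint : Integrable (fun z : ℕ → Obs => (cell q).indicator (fun _ => (1 : ℝ)) (z 0))
        (Measure.infinitePi fun _ : ℕ => P) :=
      (integrable_const (1 : ℝ)).indicator
        (measurable_pi_apply (X := fun _ : ℕ => Obs) 0 (measurableSet_cell q))
    have key := strong_law_ae_real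
      (fun (i : ℕ) (z : ℕ → Obs) => (cell q).indicator (fun _ => (1 : ℝ)) (z i)) hint
      (fun i j hij => (iIndepFun_infinitePi (P := fun _ : ℕ => P) (fun _ => hm)).indepFun hij)
      (fun i => IdentDistrib.comp (u := (cell q).indicator fun _ => (1 : ℝ))
        ⟨(measurable_pi_apply i).aemeasurable, (measurable_pi_apply 0).aemeasurable,
          by rw [hmap, hmap]⟩ hm)
    have hval : ∫ z, (cell q).indicator (fun _ => (1 : ℝ)) (z 0)
        ∂(Measure.infinitePi fun _ : ℕ => P) = P.real (cell q) := by
      rw [← integral_map (φ := fun z : ℕ → Obs => z 0) (measurable_pi_apply 0).aemeasurable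
        hm.aestronglyMeasurable, hmap]
      exact integral_indicator_one (measurableSet_cell q)
    filter_upwards [key] with z hz
    rw [hval] at hz
    exact hz.limsup_eq
  filter_upwards [ae_all_iff.2 h] with z hz
  exact funext hz

end Separation

/-! ### Measurability of the trajectory and of the observation -/

section Measurability

/-- Measurability into a second-countable metric space can be tested on distances to points,
because every open set is a countable union of balls. -/
theorem measurable_of_dist {α E : Type*} [MeasurableSpace α] [PseudoMetricSpace E]
    [SecondCountableTopology E] [MeasurableSpace E] [BorelSpace E] {u : α → E}
    (h : ∀ c, Measurable fun a => dist (u a) c) : Measurable u := by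
  refine measurable_of_isOpen fun U hU => ?_
  choose! r hr hrU using Metric.isOpen_iff.1 hU
  obtain ⟨T, hTU, hT, hTeq⟩ := TopologicalSpace.isOpen_biUnion_countable U
    (fun x => Metric.ball x (r x)) (fun x _ => Metric.isOpen_ball)
  have hUeq : U = ⋃ x ∈ T, Metric.ball x (r x) := by
    rw [hTeq]
    refine subset_antisymm (fun x hx => ?_) (Set.iUnion₂_subset hrU)
    exact Set.mem_biUnion hx (Metric.mem_ball_self (hr x hx))
  rw [hUeq, Set.preimage_iUnion₂]
  exact MeasurableSet.biUnion hT fun x _ => (h x) measurableSet_Iio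

theorem coeFn_trajectory {Ω : Type*} {X : unitInterval → Ω → ℝ} {ω : Ω}
    (h : MemLp (fun t => X t ω) 2 (volume : Measure unitInterval)) :
    trajectory X ω =ᵐ[volume] fun t => X t ω := by
  rw [trajectory, dif_pos h]
  exact h.coeFn_toLp

variable {Ω : Type*} [MeasurableSpace Ω]

theorem measurable_section {X : unitInterval → Ω → ℝ} (hX : Measurable (Function.uncurry X))
    (ω : Ω) : Measurable fun t => X t ω :=
  hX.comp measurable_prodMk_right

theorem measurableSet_memLp_section {X : unitInterval → Ω → ℝ}
    (hX : Measurable (Function.uncurry X)) :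
    MeasurableSet {ω | MemLp (fun t => X t ω) 2 (volume : Measure unitInterval)} := by
  have h : StronglyMeasurable (Function.uncurry fun (ω : Ω) (t : unitInterval) => X t ω ^ 2) :=
    ((hX.comp measurable_swap).pow_const 2).stronglyMeasurable
  simp_rw [fun ω => memLp_two_iff_integrable_sq
    (measurable_section hX ω).aestronglyMeasurable (μ := (volume : Measure unitInterval))]
  exact _root_.measurableSet_integrable (μ := (volume : Measure unitInterval)) h

theorem measurable_trajectory {X : unitInterval → Ω → ℝ} (hX : Measurable (Function.uncurry X)) :
    Measurable (trajectory X) := by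
  classical
  refine measurable_of_dist fun c => ?_
  have hM := measurableSet_memLp_section hX
  have hc : Measurable c := (Lp.stronglyMeasurable c).measurable
  have hint : Measurable fun ω => ∫ t, (X t ω - c t) * (X t ω - c t) := by
    have h : StronglyMeasurable
        (Function.uncurry fun (ω : Ω) (t : unitInterval) => (X t ω - c t) * (X t ω - c t)) := by
      have h1 : Measurable fun x : Ω × unitInterval => X x.2 x.1 - c x.2 :=
        (hX.comp measurable_swap).sub (hc.comp measurable_snd)
      exact (h1.mul h1).stronglyMeasurable
    exact h.integral_prod_right.measurable
  have heq : (fun ω => dist (trajectory X ω) c) =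
      {ω | MemLp (fun t => X t ω) 2 (volume : Measure unitInterval)}.piecewise
        (fun ω => √(∫ t, (X t ω - c t) * (X t ω - c t))) (fun _ => dist 0 c) := by
    ext ω
    by_cases h : MemLp (fun t => X t ω) 2 (volume : Measure unitInterval)
    · have h' : ω ∈ {ω | MemLp (fun t => X t ω) 2 (volume : Measure unitInterval)} := h
      rw [Set.piecewise_eq_of_mem _ _ _ h', dist_eq_norm, @norm_eq_sqrt_real_inner _ _ _
        (trajectory X ω - c), L2.inner_def]
      congr 1
      refine integral_congr_ae ?_
      filter_upwards [Lp.coeFn_sub (trajectory X ω) c, coeFn_trajectory h] with t h1 h2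
      rw [h1, Pi.sub_apply, h2]
      rfl
    · have h' : ω ∉ {ω | MemLp (fun t => X t ω) 2 (volume : Measure unitInterval)} := h
      rw [Set.piecewise_eq_of_notMem _ _ _ h', trajectory, dif_neg h]
  rw [heq]
  exact (hint.sqrt).piecewise hM measurable_const

theorem measurable_param {α : Type*} [MeasurableSpace α] {u : Param → α}
    (h : ∀ p, Measurable fun x : ParamOf p => u ⟨p, x⟩) : Measurable u := by
  intro s hs
  exact MeasurableSpace.measurableSet_iInf.2 fun p => h p hs

theorem measurableSet_numComp (p : ℕ+) : MeasurableSet (numComp p) :=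
  measurableSet_setOfPred.2 (measurable_param fun q =>
    (measurable_const : Measurable fun _ : ParamOf q => q = p))

/-- Measurability on `Param × W` can be tested on the products `ParamOf p × W`. -/
theorem measurable_param_prod {α W : Type*} [MeasurableSpace α] [MeasurableSpace W]
    {u : Param × W → α} (h : ∀ p, Measurable fun x : ParamOf p × W => u (⟨p, x.1⟩, x.2)) :
    Measurable u := by
  classical
  -- extending the projection to the fibre over `p` arbitrarily makes it a map on all of `Param`
  let toFibre : ∀ p : ℕ+, Param → ParamOf p := fun p θ =>
    if hp : θ.1 = p then hp ▸ θ.2 else (0, 0, 0, 0)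
  have hfib : ∀ p, Measurable (toFibre p) := by
    intro p
    refine measurable_param fun q => ?_
    by_cases hq : q = p
    · subst hq
      simpa [toFibre] using measurable_id'
    · simp [toFibre, hq]
  intro s hs
  have : u ⁻¹' s = ⋃ p : ℕ+, (Prod.fst ⁻¹' numComp p) ∩
      (fun x : Param × W => u (⟨p, toFibre p x.1⟩, x.2)) ⁻¹' s := by
    ext ⟨⟨q, y⟩, w⟩
    simp only [Set.mem_preimage, Set.mem_iUnion, Set.mem_inter_iff, numComp, Set.mem_ofPred_eq]
    constructor
    · intro hx
      exact ⟨q, rfl, by simpa [toFibre] using hx⟩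
    · rintro ⟨p, rfl, hx⟩
      simpa [toFibre] using hx
  rw [this]
  refine MeasurableSet.iUnion fun p => (measurable_fst (measurableSet_numComp p)).inter ?_
  exact ((h p).comp (((hfib p).comp measurable_fst).prodMk measurable_snd)) hs

/-- The observation as a function of the parameter, the covariate and a standard normal
variable. -/
def observe (X : unitInterval → Ω → ℝ) (x : Param × (Ω × ℝ)) : Obs :=
  (trajectory X x.2.1, regMean X x.1 x.2.1 + √(x.1.2.errVar : ℝ) * x.2.2)

theorem measurable_observe {X : unitInterval → Ω → ℝ} (hX : Measurable (Function.uncurry X)) :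
    Measurable (observe X) := by
  refine ((measurable_trajectory hX).comp (measurable_fst.comp measurable_snd)).prodMk ?_
  refine measurable_param_prod fun p => ?_
  change Measurable fun x : ParamOf p × (Ω × ℝ) => x.1.intercept
    + ∑ j, x.1.coef j * X (x.1.time j) x.2.1 + √(x.1.errVar : ℝ) * x.2.2
  refine Measurable.add (Measurable.add ?_ (Finset.measurable_fun_sum _ fun j _ => ?_)) ?_
  · unfold ParamOf.intercept; fun_prop
  · refine Measurable.mul ?_ ?_
    · unfold ParamOf.coef; fun_prop
    · refine hX.comp (Measurable.prodMk ?_ (by fun_prop))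
      exact (measurable_pi_apply j).comp (measurable_fst.comp (measurable_snd.comp measurable_fst))
  · unfold ParamOf.errVar; fun_prop

theorem measurable_regMean {X : unitInterval → Ω → ℝ} (hX : Measurable (Function.uncurry X))
    (θ : Param) : Measurable (regMean X θ) := by
  refine Measurable.add measurable_const (Finset.measurable_sum _ fun j _ => ?_)
  exact (hX.comp measurable_prodMk_left).const_mul _

theorem measurable_dataMap {X : unitInterval → Ω → ℝ} (hX : Measurable (Function.uncurry X))
    (θ : Param) : Measurable fun q : Ω × ℝ => (trajectory X q.1, regMean X θ q.1 + q.2) :=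
  ((measurable_trajectory hX).comp measurable_fst).prodMk
    (((measurable_regMean hX θ).comp measurable_fst).add measurable_snd)

theorem dataLaw_eq_map_observe {X : unitInterval → Ω → ℝ} (hX : Measurable (Function.uncurry X))
    (μ : Measure Ω) [IsProbabilityMeasure μ] (θ : Param) :
    dataLaw μ X θ = (μ.prod (gaussianReal 0 1)).map fun w => observe X (θ, w) := by
  have h1 : gaussianReal 0 θ.2.errVar =
      (gaussianReal 0 1).map (√(θ.2.errVar : ℝ) * ·) := by
    rw [gaussianReal_map_const_mul]
    congr 1
    · simp
    · ext; simp
  have h2 : μ.prod (gaussianReal 0 θ.2.errVar) = (μ.prod (gaussianReal 0 1)).map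
      (Prod.map id (√(θ.2.errVar : ℝ) * ·)) := by
    rw [h1, ← Measure.map_prod_map _ _ measurable_id (measurable_const_mul _), Measure.map_id]
  rw [dataLaw, h2, Measure.map_map (measurable_dataMap hX θ) (by fun_prop)]
  rfl

theorem isProbabilityMeasure_dataLaw {X : unitInterval → Ω → ℝ}
    (hX : Measurable (Function.uncurry X)) (μ : Measure Ω) [IsProbabilityMeasure μ] (θ : Param) :
    IsProbabilityMeasure (dataLaw μ X θ) :=
  Measure.isProbabilityMeasure_map (measurable_dataMap hX θ).aemeasurable

end Measurability

/-! ### Moments of the data law -/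

section Moments

variable {Ω : Type*} [MeasurableSpace Ω] {μ : Measure Ω} {X : unitInterval → Ω → ℝ}

namespace IsCovariateProcess

theorem inner_trajectory_ae (hX : IsCovariateProcess μ X) (g : C(unitInterval, ℝ)) :
    ∀ᵐ ω ∂μ, inner ℝ (FunctionalRegression.trajectory X ω) (ContinuousMap.toLp 2 volume ℝ g) =
      ∫ s, X s ω * g s := by
  filter_upwards [hX.trajectory] with ω h
  rw [L2.inner_def]
  refine integral_congr_ae ?_
  filter_upwards [coeFn_trajectory h, ContinuousMap.coeFn_toLp (𝕜 := ℝ) (p := 2) volume g]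
    with s h1 h2
  rw [h1, h2]
  exact mul_comm _ _

theorem integrable_sq_fst (hX : IsCovariateProcess μ X) (t : unitInterval) :
    Integrable (fun x : Ω × unitInterval => X t x.1 ^ 2) (μ.prod volume) :=
  (hX.secondOrder t).integrable_sq.comp_fst volume

variable [IsProbabilityMeasure μ]

/-- Tonelli's theorem, as `∫ K(s, s) ds` is finite. -/
theorem integrable_sq_uncurry (hX : IsCovariateProcess μ X) :
    Integrable (fun x : Ω × unitInterval => X x.2 x.1 ^ 2) (μ.prod volume) := by
  have hm : Measurable fun x : Ω × unitInterval => X x.2 x.1 ^ 2 :=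
    (hX.measurable.comp measurable_swap).pow_const 2
  refine (integrable_prod_iff' hm.aestronglyMeasurable).2
    ⟨ae_of_all _ fun s => (hX.secondOrder s).integrable_sq, ?_⟩
  have hK : Continuous fun s => covFun μ X s s :=
    hX.cov_continuous.comp (continuous_id.prodMk continuous_id)
  have : (fun s => ∫ ω, ‖X s ω ^ 2‖ ∂μ) = fun s => covFun μ X s s := by
    ext s
    refine integral_congr_ae (ae_of_all _ fun ω => ?_)
    exact (Real.norm_of_nonneg (sq_nonneg (X s ω))).trans (sq (X s ω))
  rw [this]
  exact hK.integrable_of_hasCompactSupport (HasCompactSupport.of_compactSpace _)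

theorem integrable_mul_prod (hX : IsCovariateProcess μ X) (t : unitInterval)
    (g : C(unitInterval, ℝ)) :
    Integrable (fun x : Ω × unitInterval => X t x.1 * (X x.2 x.1 * g x.2)) (μ.prod volume) := by
  have hm : Measurable fun x : Ω × unitInterval => X t x.1 * (X x.2 x.1 * g x.2) := by
    refine Measurable.mul ?_ (Measurable.mul (hX.measurable.comp measurable_swap) ?_)
    · exact (hX.measurable.comp measurable_prodMk_left).comp measurable_fst
    · exact g.continuous.measurable.comp measurable_snd
  refine (((hX.integrable_sq_fst t).add hX.integrable_sq_uncurry).const_mul ‖g‖).mono'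
    hm.aestronglyMeasurable (ae_of_all _ fun x => ?_)
  have h1 : |g x.2| ≤ ‖g‖ := g.norm_coe_le_norm x.2
  have h2 : |X t x.1| * |X x.2 x.1| ≤ X t x.1 ^ 2 + X x.2 x.1 ^ 2 := by
    nlinarith [sq_abs (X t x.1), sq_abs (X x.2 x.1), sq_nonneg (|X t x.1| - |X x.2 x.1|),
      sq_nonneg (X t x.1), sq_nonneg (X x.2 x.1)]
  simp only [Real.norm_eq_abs, abs_mul, Pi.add_apply]
  calc |X t x.1| * (|X x.2 x.1| * |g x.2|) = |g x.2| * (|X t x.1| * |X x.2 x.1|) := by ring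
    _ ≤ ‖g‖ * (X t x.1 ^ 2 + X x.2 x.1 ^ 2) := by gcongr

theorem integrable_prod (hX : IsCovariateProcess μ X) (g : C(unitInterval, ℝ)) :
    Integrable (fun x : Ω × unitInterval => X x.2 x.1 * g x.2) (μ.prod volume) := by
  have hm : Measurable fun x : Ω × unitInterval => X x.2 x.1 * g x.2 :=
    (hX.measurable.comp measurable_swap).mul (g.continuous.measurable.comp measurable_snd)
  refine (((integrable_const (1 : ℝ)).add hX.integrable_sq_uncurry).const_mul ‖g‖).mono'
    hm.aestronglyMeasurable (ae_of_all _ fun x => ?_)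
  have h1 : |g x.2| ≤ ‖g‖ := g.norm_coe_le_norm x.2
  have h2 : |X x.2 x.1| ≤ 1 + X x.2 x.1 ^ 2 := by
    nlinarith [sq_abs (X x.2 x.1), sq_nonneg (|X x.2 x.1| - 1)]
  simp only [Real.norm_eq_abs, abs_mul, Pi.add_apply]
  calc |X x.2 x.1| * |g x.2| = |g x.2| * |X x.2 x.1| := by ring
    _ ≤ ‖g‖ * (1 + X x.2 x.1 ^ 2) := by gcongr

theorem integrable_integral (hX : IsCovariateProcess μ X) (g : C(unitInterval, ℝ)) :
    Integrable (fun ω => ∫ s, X s ω * g s) μ :=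
  (hX.integrable_prod g).integral_prod_left

theorem integral_integral_eq_zero (hX : IsCovariateProcess μ X) (g : C(unitInterval, ℝ)) :
    ∫ ω, (∫ s, X s ω * g s) ∂μ = 0 := by
  rw [integral_integral_swap (f := fun ω s => X s ω * g s) (hX.integrable_prod g)]
  simp [integral_mul_const, hX.centered]

theorem integrable_mul_integral (hX : IsCovariateProcess μ X) (t : unitInterval)
    (g : C(unitInterval, ℝ)) : Integrable (fun ω => X t ω * ∫ s, X s ω * g s) μ := by
  simpa only [integral_const_mul] using (hX.integrable_mul_prod t g).integral_prod_left

/-- The covariance of `X t` with the linear functional `g` of the trajectory, by Fubini's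
theorem. -/
theorem integral_mul_integral (hX : IsCovariateProcess μ X) (t : unitInterval)
    (g : C(unitInterval, ℝ)) :
    ∫ ω, X t ω * (∫ s, X s ω * g s) ∂μ = ∫ s, covFun μ X t s * g s := by
  simp_rw [← integral_const_mul]
  rw [integral_integral_swap (f := fun ω s => X t ω * (X s ω * g s)) (hX.integrable_mul_prod t g)]
  simp_rw [← mul_assoc, integral_mul_const]
  rfl

theorem memLp_regMean (hX : IsCovariateProcess μ X) (θ : Param) : MemLp (regMean X θ) 2 μ := by
  have h : MemLp (fun ω => ∑ j, θ.2.coef j * X (θ.2.time j) ω) 2 μ :=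
    memLp_finsetSum (f := fun j ω => θ.2.coef j * X (θ.2.time j) ω) Finset.univ
      fun j _ => (hX.secondOrder (θ.2.time j)).const_mul (θ.2.coef j)
  have h' := MemLp.add (memLp_const (p := 2) (μ := μ) θ.2.intercept) h
  exact h'

theorem integral_regMean (hX : IsCovariateProcess μ X) (θ : Param) :
    ∫ ω, regMean X θ ω ∂μ = θ.2.intercept := by
  have hi : ∀ t, Integrable (X t) μ := fun t => (hX.secondOrder t).integrable (by norm_num)
  unfold regMean
  rw [integral_add (integrable_const _) (integrable_finsetSum _ fun j _ => (hi _).const_mul _),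
    integral_finsetSum _ fun j _ => (hi _).const_mul _]
  simp [integral_const_mul, hX.centered]

theorem integrable_regMean_mul (hX : IsCovariateProcess μ X) (θ : Param)
    (g : C(unitInterval, ℝ)) : Integrable (fun ω => regMean X θ ω * ∫ s, X s ω * g s) μ := by
  simp only [regMean, add_mul, Finset.sum_mul, mul_assoc]
  exact ((hX.integrable_integral g).const_mul _).add
    (integrable_finsetSum _ fun j _ => (hX.integrable_mul_integral _ g).const_mul _)

theorem integral_regMean_mul (hX : IsCovariateProcess μ X) (θ : Param)
    (g : C(unitInterval, ℝ)) : ∫ ω, regMean X θ ω * (∫ s, X s ω * g s) ∂μ =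
      ∫ s, (∑ j, θ.2.coef j * covFun μ X (θ.2.time j) s) * g s := by
  simp only [regMean, add_mul, Finset.sum_mul, mul_assoc]
  have hK : ∀ t, Continuous fun s => covFun μ X t s := fun t =>
    hX.cov_continuous.comp (Continuous.prodMk_right t)
  rw [integral_add ((hX.integrable_integral g).const_mul _)
      (integrable_finsetSum _ fun j _ => (hX.integrable_mul_integral _ g).const_mul _),
    integral_finsetSum _ fun j _ => (hX.integrable_mul_integral _ g).const_mul _,
    integral_const_mul, hX.integral_integral_eq_zero, mul_zero, zero_add,
    integral_finsetSum]
  · simp [integral_const_mul, hX.integral_mul_integral]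
  · intro j _
    exact (continuous_const.mul ((hK _).mul g.continuous)).integrable_of_hasCompactSupport
      (HasCompactSupport.of_compactSpace _)

end IsCovariateProcess

variable [IsProbabilityMeasure μ]

/-- The mean of the response is the intercept. -/
theorem integral_snd_dataLaw (hX : IsCovariateProcess μ X) (θ : Param) :
    ∫ z, z.2 ∂dataLaw μ X θ = θ.2.intercept := by
  have h1 : Integrable (regMean X θ) μ := (hX.memLp_regMean θ).integrable (by norm_num)
  have h2 : Integrable (fun x : ℝ => x) (gaussianReal 0 θ.2.errVar) :=
    (memLp_id_gaussianReal' 1 (by norm_num)).integrable le_rfl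
  rw [dataLaw, integral_map (measurable_dataMap hX.measurable θ).aemeasurable
    measurable_snd.aestronglyMeasurable]
  simp only
  rw [integral_add (h1.comp_fst _) (h2.comp_snd _), integral_fun_fst,
    integral_fun_snd (f := fun x => x),
    integral_id_gaussianReal]
  simp [hX.integral_regMean]

/-- The second moment of the response. -/
theorem integral_snd_sq_dataLaw (hX : IsCovariateProcess μ X) (θ : Param) :
    ∫ z, z.2 ^ 2 ∂dataLaw μ X θ = ∫ ω, regMean X θ ω ^ 2 ∂μ + θ.2.errVar := by
  have h0 := hX.memLp_regMean θ
  have h1 : Integrable (regMean X θ) μ := h0.integrable (by norm_num)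
  have g0 : MemLp (fun x : ℝ => x) 2 (gaussianReal 0 θ.2.errVar) :=
    memLp_id_gaussianReal' 2 (by norm_num)
  have h2 : Integrable (fun x : ℝ => x) (gaussianReal 0 θ.2.errVar) :=
    g0.integrable (by norm_num)
  have hvar : ∫ x, x ^ 2 ∂gaussianReal 0 θ.2.errVar = θ.2.errVar := by
    rw [← variance_fun_id_gaussianReal (μ := 0) (v := θ.2.errVar),
      variance_of_integral_eq_zero (by fun_prop) integral_id_gaussianReal]
  rw [dataLaw, integral_map (measurable_dataMap hX.measurable θ).aemeasurable
    (measurable_snd.pow_const 2).aestronglyMeasurable]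
  have hexp : ∀ q : Ω × ℝ, (regMean X θ q.1 + q.2) ^ 2 =
      regMean X θ q.1 ^ 2 + 2 * (regMean X θ q.1 * q.2) + q.2 ^ 2 := fun q => by ring
  simp only [hexp]
  have i1 := h0.integrable_sq.comp_fst (gaussianReal 0 θ.2.errVar)
  have i2 := (h1.mul_prod h2).const_mul 2
  have i3 := g0.integrable_sq.comp_snd μ
  rw [integral_add (f := fun q : Ω × ℝ => regMean X θ q.1 ^ 2 + 2 * (regMean X θ q.1 * q.2))
      (i1.add i2) i3, integral_add i1 i2, integral_const_mul,
    integral_prod_mul (regMean X θ) (fun x => x), integral_id_gaussianReal, integral_fun_fst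
      (f := fun ω => regMean X θ ω ^ 2),
    integral_fun_snd (f := fun x => x ^ 2), hvar]
  simp

/-- The cross moment of the response with a linear functional of the curve. -/
theorem integral_snd_mul_inner_dataLaw (hX : IsCovariateProcess μ X) (θ : Param)
    (g : C(unitInterval, ℝ)) :
    ∫ z, z.2 * inner ℝ z.1 (ContinuousMap.toLp 2 volume ℝ g) ∂dataLaw μ X θ =
      ∫ s, (∑ j, θ.2.coef j * covFun μ X (θ.2.time j) s) * g s := by
  have h2 : Integrable (fun x : ℝ => x) (gaussianReal 0 θ.2.errVar) :=
    (memLp_id_gaussianReal' 1 (by norm_num)).integrable le_rfl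
  have hm : Measurable fun z : Obs => z.2 * inner ℝ z.1 (ContinuousMap.toLp 2 volume ℝ g) :=
    measurable_snd.mul ((continuous_id.inner continuous_const).measurable.comp measurable_fst)
  rw [dataLaw, integral_map (measurable_dataMap hX.measurable θ).aemeasurable
    hm.aestronglyMeasurable]
  have hae : ∀ᵐ q ∂μ.prod (gaussianReal 0 θ.2.errVar),
      inner ℝ (FunctionalRegression.trajectory X q.1) (ContinuousMap.toLp 2 volume ℝ g) = ∫ s, X s q.1 * g s :=
    Measure.quasiMeasurePreserving_fst.ae (hX.inner_trajectory_ae g)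
  have hcongr : (fun q : Ω × ℝ => (regMean X θ q.1 + q.2) *
      inner ℝ (FunctionalRegression.trajectory X q.1) (ContinuousMap.toLp 2 volume ℝ g))
      =ᵐ[μ.prod (gaussianReal 0 θ.2.errVar)] fun q =>
      regMean X θ q.1 * (∫ s, X s q.1 * g s) + (∫ s, X s q.1 * g s) * q.2 := by
    filter_upwards [hae] with q hq
    rw [hq]; ring
  rw [integral_congr_ae hcongr, integral_add ((hX.integrable_regMean_mul θ g).comp_fst _)
    ((hX.integrable_integral g).mul_prod h2),
    integral_fun_fst (f := fun ω => regMean X θ ω * ∫ s, X s ω * g s),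
    integral_prod_mul (fun ω => ∫ s, X s ω * g s) (fun x => x), integral_id_gaussianReal,
    hX.integral_regMean_mul]
  simp

end Moments

/-! ### Identification of the parameter -/

section Identification

variable {Ω : Type*} [MeasurableSpace Ω] {μ : Measure Ω} {X : unitInterval → Ω → ℝ}

/-- The discrete signed measure `∑ⱼ βⱼ δ_{tⱼ}`, as a finitely supported function on `[0,1]`. -/
def weights {p : ℕ+} (x : ParamOf p) : unitInterval →₀ ℝ :=
  ∑ j, Finsupp.single (x.time j) (x.coef j)

theorem weights_time {p : ℕ+} {x : ParamOf p} (hx : Function.Injective x.time)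
    (j : Fin (p : ℕ)) : weights x (x.time j) = x.coef j := by
  rw [weights, Finsupp.finsetSum_apply, Finset.sum_eq_single j]
  · simp
  · intro i _ hij
    exact Finsupp.single_eq_of_ne fun h => hij (hx h.symm)
  · simp

theorem support_weights {p : ℕ+} {x : ParamOf p} (hx : Function.Injective x.time)
    (hc : ∀ j, x.coef j ≠ 0) : (weights x).support = Finset.univ.image x.time := by
  ext t
  simp only [Finsupp.mem_support_iff, Finset.mem_image, Finset.mem_univ, true_and]
  constructor
  · intro ht
    by_contra! h
    refine ht ?_
    rw [weights, Finsupp.finsetSum_apply]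
    exact Finset.sum_eq_zero fun j _ => Finsupp.single_eq_of_ne (h j).symm
  · rintro ⟨j, rfl⟩
    rw [weights_time hx]
    exact hc j

theorem linearCombination_weights {p : ℕ+} (x : ParamOf p) (k : unitInterval → ℝ) :
    Finsupp.linearCombination ℝ k (weights x) = ∑ j, x.coef j * k (x.time j) := by
  simp [weights, map_sum, Finsupp.linearCombination_single]

/-- The sections `K(t, ·)` of a strictly positive definite kernel are linearly independent. -/
theorem IsCovariateProcess.eq_zero_of_linearCombination (hX : IsCovariateProcess μ X)
    {c : unitInterval →₀ ℝ}
    (hc : ∀ s, Finsupp.linearCombination ℝ (fun t => covFun μ X t s) c = 0) : c = 0 := by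
  by_contra hne
  let e := c.support.equivFin
  let t : Fin c.support.card → unitInterval := fun i => (e.symm i : unitInterval)
  have ht : Function.Injective t := Subtype.val_injective.comp e.symm.injective
  have ha : (fun i => c (t i)) ≠ 0 := by
    obtain ⟨u, hu⟩ := Finsupp.support_nonempty_iff.2 hne
    intro h0
    have := congrFun h0 (e ⟨u, hu⟩)
    simp only [t, Equiv.symm_apply_apply, Pi.zero_apply] at this
    exact (Finsupp.mem_support_iff.1 hu) this
  have hpos := hX.cov_strictPosDef _ t ht _ ha
  have hsum : ∀ s, ∑ i, c (t i) * covFun μ X (t i) s = 0 := by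
    intro s
    rw [← hc s, Finsupp.linearCombination_apply, Finsupp.sum, ← Finset.sum_coe_sort c.support]
    exact Equiv.sum_comp e.symm fun u : c.support => c u * covFun μ X u s
  rw [Finset.sum_comm] at hpos
  refine hpos.ne' (Finset.sum_eq_zero fun j _ => ?_)
  rw [← mul_zero (c (t j)), ← hsum (t j), Finset.mul_sum]
  exact Finset.sum_congr rfl fun i _ => by ring

instance : (volume : Measure unitInterval).IsOpenPosMeasure := by
  refine ⟨fun V hV ⟨x, hx⟩ h0 => ?_⟩
  obtain ⟨O, hO, rfl⟩ := isOpen_induced_iff.1 hV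
  rw [unitInterval.volume_apply, Subtype.image_preimage_coe] at h0
  have hcl : (x : ℝ) ∈ closure (Set.Ioo (0 : ℝ) 1) := by
    rw [closure_Ioo zero_ne_one]
    exact x.2
  have hne : (O ∩ Set.Ioo (0 : ℝ) 1).Nonempty := mem_closure_iff.1 hcl O hO hx
  refine ((hO.inter isOpen_Ioo).measure_pos volume hne).ne' (measure_mono_null ?_ h0)
  exact fun y hy => ⟨Set.Ioo_subset_Icc_self hy.2, hy.1⟩

/-- The data law determines `∑ⱼ βⱼ δ_{tⱼ}`: the cross moments of `Y` with the linear functionals of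
`X` determine `∑ⱼ βⱼ K(tⱼ, ·)`. -/
theorem IsCovariateProcess.weights_eq [IsProbabilityMeasure μ] (hX : IsCovariateProcess μ X)
    {θ θ' : Param} (h : dataLaw μ X θ = dataLaw μ X θ') : weights θ.2 = weights θ'.2 := by
  have hK : ∀ t, Continuous fun s => covFun μ X t s := fun t =>
    hX.cov_continuous.comp (Continuous.prodMk_right t)
  have hs : ∀ θ : Param, Continuous fun s => ∑ j, θ.2.coef j * covFun μ X (θ.2.time j) s :=
    fun θ => continuous_finsetSum _ fun j _ => continuous_const.mul (hK _)
  -- the difference of the two functions is the test function that shows it to vanish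
  let D : C(unitInterval, ℝ) := ⟨fun s => (∑ j, θ.2.coef j * covFun μ X (θ.2.time j) s) -
    ∑ j, θ'.2.coef j * covFun μ X (θ'.2.time j) s, (hs θ).sub (hs θ')⟩
  have hi : ∀ θ : Param, Integrable
      (fun s => (∑ j, θ.2.coef j * covFun μ X (θ.2.time j) s) * D s) volume := fun θ =>
    ((hs θ).mul D.continuous).integrable_of_hasCompactSupport (HasCompactSupport.of_compactSpace _)
  have hD : ∫ s, D s * D s = 0 := by
    have h1 : ∫ s, (∑ j, θ.2.coef j * covFun μ X (θ.2.time j) s) * D s =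
        ∫ s, (∑ j, θ'.2.coef j * covFun μ X (θ'.2.time j) s) * D s := by
      rw [← integral_snd_mul_inner_dataLaw hX, ← integral_snd_mul_inner_dataLaw hX, h]
    rw [← sub_eq_zero, ← integral_sub (hi θ) (hi θ')] at h1
    rw [← h1]
    exact integral_congr_ae (ae_of_all _ fun s => sub_mul _ _ _)
  have hD0 : (fun s => D s * D s) = 0 := by
    have hc : Continuous fun s => D s * D s := D.continuous.mul D.continuous
    rw [integral_eq_zero_iff_of_nonneg (fun s => mul_self_nonneg _)
      (hc.integrable_of_hasCompactSupport (HasCompactSupport.of_compactSpace _))] at hD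
    exact (hc.ae_eq_iff_eq volume continuous_zero).1 hD
  rw [← sub_eq_zero]
  refine hX.eq_zero_of_linearCombination fun s => ?_
  rw [map_sub, linearCombination_weights, linearCombination_weights]
  exact mul_self_eq_zero.1 (congrFun hD0 s)

/-- The parameters with increasing times and non-vanishing coefficients: one representative of
each class of identifiable parameters up to relabelling. -/
def sortedParam : Set Param := {θ | StrictMono θ.2.time ∧ ∀ j, θ.2.coef j ≠ 0}

/-- Sorted parameters are identifiable from the first and second moments of the data. -/
theorem IsCovariateProcess.injOn_dataLaw [IsProbabilityMeasure μ] (hX : IsCovariateProcess μ X) :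
    Set.InjOn (dataLaw μ X) sortedParam := by
  rintro ⟨p, x⟩ ⟨hxt, hxc⟩ ⟨q, y⟩ ⟨hyt, hyc⟩ h
  have hw : weights x = weights y := hX.weights_eq h
  have hsupp : Finset.univ.image x.time = Finset.univ.image y.time := by
    rw [← support_weights hxt.injective hxc, ← support_weights hyt.injective hyc, hw]
  obtain rfl : p = q := by
    have hcard := congrArg Finset.card hsupp
    rw [Finset.card_image_of_injective _ hxt.injective,
      Finset.card_image_of_injective _ hyt.injective] at hcard
    simpa using hcard
  have htime : x.time = y.time := by
    refine (hxt.range_inj hyt).1 ?_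
    simpa using congrArg (fun s : Finset unitInterval => (s : Set unitInterval)) hsupp
  have hcoef : x.coef = y.coef := by
    ext j
    rw [← weights_time hxt.injective, ← weights_time hyt.injective, hw, htime]
  have hint : x.intercept = y.intercept := by
    have h1 := integral_snd_dataLaw hX ⟨p, x⟩
    rw [h, integral_snd_dataLaw hX] at h1
    exact h1.symm
  have hreg : regMean X ⟨p, x⟩ = regMean X ⟨p, y⟩ := by
    ext ω
    simp only [regMean, htime, hcoef, hint]
  have hvar : x.errVar = y.errVar := by
    have h1 := integral_snd_sq_dataLaw hX ⟨p, x⟩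
    rw [h, integral_snd_sq_dataLaw hX, hreg] at h1
    exact (NNReal.coe_injective (add_left_cancel h1)).symm
  have hxy : x = y := Prod.ext hcoef (Prod.ext htime (Prod.ext hint hvar))
  rw [hxy]

end Identification

/-! ### Relabelling and permutation balls -/

section Symmetrization

variable {p : ℕ+}

theorem measurable_relabel (ν : Equiv.Perm (Fin (p : ℕ))) :
    Measurable fun x : ParamOf p => x.relabel ν := by
  unfold ParamOf.relabel ParamOf.coef ParamOf.time ParamOf.intercept ParamOf.errVar
  fun_prop

theorem relabel_relabel (x : ParamOf p) (ν τ : Equiv.Perm (Fin (p : ℕ))) :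
    (x.relabel ν).relabel τ = x.relabel (ν * τ) := rfl

theorem relabel_one (x : ParamOf p) : x.relabel 1 = x := rfl

theorem dataLaw_relabel {Ω : Type*} [MeasurableSpace Ω] (μ : Measure Ω)
    (X : unitInterval → Ω → ℝ) (x : ParamOf p) (ν : Equiv.Perm (Fin (p : ℕ))) :
    dataLaw μ X ⟨p, x.relabel ν⟩ = dataLaw μ X ⟨p, x⟩ := by
  have h : regMean X ⟨p, x.relabel ν⟩ = regMean X ⟨p, x⟩ := by
    ext ω
    exact congrArg (x.intercept + ·) (Equiv.sum_comp ν fun j => x.coef j * X (x.time j) ω)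
  simp only [dataLaw, h]
  rfl

theorem exists_relabel_mem_sortedParam {x : ParamOf p} (ht : Function.Injective x.time)
    (hc : ∀ j, x.coef j ≠ 0) : ∃ ν, (⟨p, x.relabel ν⟩ : Param) ∈ sortedParam :=
  ⟨Tuple.sort x.time, (Tuple.monotone_sort x.time).strictMono_of_injective
    (ht.comp (Tuple.sort x.time).injective), fun _ => hc _⟩

theorem euclDist_relabel (x y : ParamOf p) (ν : Equiv.Perm (Fin (p : ℕ))) :
    (x.relabel ν).euclDist (y.relabel ν) = x.euclDist y := by
  unfold ParamOf.euclDist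
  congr 4
  · exact Equiv.sum_comp ν fun j => (x.coef j - y.coef j) ^ 2
  · exact Equiv.sum_comp ν fun j => ((x.time j : ℝ) - y.time j) ^ 2

theorem continuous_euclDist (y : ParamOf p) : Continuous fun x : ParamOf p => x.euclDist y := by
  unfold ParamOf.euclDist ParamOf.coef ParamOf.time ParamOf.intercept ParamOf.errVar
  fun_prop

theorem euclDist_self (x : ParamOf p) : x.euclDist x = 0 := by
  simp [ParamOf.euclDist]

/-- The parameters with `p` components that have a relabelling in `U`. -/
def symmetrize (U : Set (ParamOf p)) : Set Param := Sigma.mk p '' {x | ∃ ν, x.relabel ν ∈ U}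

theorem measurableSet_setOf_relabel {U : Set (ParamOf p)} (hU : MeasurableSet U) :
    MeasurableSet {x : ParamOf p | ∃ ν, x.relabel ν ∈ U} := by
  have : {x : ParamOf p | ∃ ν, x.relabel ν ∈ U} = ⋃ ν, (fun x => x.relabel ν) ⁻¹' U := by
    ext x; simp
  rw [this]
  exact MeasurableSet.iUnion fun ν => measurable_relabel ν hU

theorem measurableSet_symmetrize {U : Set (ParamOf p)} (hU : MeasurableSet U) :
    MeasurableSet (symmetrize U) := by
  refine MeasurableSpace.measurableSet_iInf.2 fun q => ?_
  change MeasurableSet (Sigma.mk q ⁻¹' symmetrize U)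
  by_cases hq : q = p
  · subst hq
    rw [symmetrize, Set.preimage_image_eq _ sigma_mk_injective]
    exact measurableSet_setOf_relabel hU
  · have : Sigma.mk q ⁻¹' symmetrize U = (∅ : Set (ParamOf q)) := by
      refine Set.eq_empty_of_forall_notMem ?_
      rintro y ⟨x, -, hxy⟩
      exact hq (congrArg Sigma.fst hxy).symm
    rw [this]
    exact MeasurableSet.empty

/-- Around each parameter, a permutation ball contains the symmetrization of some set of the
countable basis. -/
theorem exists_symmetrize_subset_permBall (x₀ : ParamOf p) {ε : ℝ} (hε : 0 < ε) :
    ∃ U ∈ TopologicalSpace.countableBasis (ParamOf p),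
      (⟨p, x₀⟩ : Param) ∈ symmetrize U ∧ symmetrize U ⊆ permBall ⟨p, x₀⟩ ε := by
  have hopen : IsOpen {x : ParamOf p | x.euclDist x₀ < ε} :=
    isOpen_lt (continuous_euclDist x₀) continuous_const
  obtain ⟨U, hU, hxU, hUε⟩ := (TopologicalSpace.isBasis_countableBasis
    (ParamOf p)).exists_subset_of_mem_open (a := x₀) (by simpa [euclDist_self] using hε) hopen
  refine ⟨U, hU, ⟨x₀, ⟨1, hxU⟩, rfl⟩, ?_⟩
  rintro _ ⟨x, ⟨ν, hν⟩, rfl⟩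
  refine Set.mem_iUnion.2 ⟨ν⁻¹, ?_⟩
  have h1 : (x.relabel ν).euclDist x₀ < ε := hUε hν
  have h2 : x.euclDist (x₀.relabel ν⁻¹) = (x.relabel ν).euclDist x₀ := by
    rw [← euclDist_relabel x _ ν, relabel_relabel, inv_mul_cancel, relabel_one]
  change paramDist _ _ < ε
  rw [paramDist, dif_pos rfl]
  exact (min_le_left _ _).trans_lt (h2.trans_lt h1)

theorem permBall_subset_numComp (θ₀ : Param) {ε : ℝ} (hε : ε ≤ 1) :
    permBall θ₀ ε ⊆ numComp θ₀.1 := by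
  intro θ hθ
  obtain ⟨ν, hν⟩ := Set.mem_iUnion.1 hθ
  by_contra hne
  change paramDist _ _ < ε at hν
  rw [paramDist, dif_neg fun h => hne h.symm] at hν
  exact absurd hν hε.not_gt

end Symmetrization

/-! ### Membership in a symmetrized set, in terms of cell probabilities -/

section Recovery

variable {Ω : Type*} [MeasurableSpace Ω] {μ : Measure Ω} [IsProbabilityMeasure μ]
  {X : unitInterval → Ω → ℝ}

/-- The probabilities of the cells under the data law of `θ`: a code of the data law in a
countable product of lines. -/
def cellProb (μ : Measure Ω) (X : unitInterval → Ω → ℝ) (θ : Param) (q : ℚ) : ℝ :=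
  (dataLaw μ X θ).real (cell q)

theorem measurable_cellProb (hX : IsCovariateProcess μ X) : Measurable (cellProb μ X) := by
  refine measurable_pi_lambda _ fun q => Measurable.ennreal_toReal ?_
  have hm := measurable_observe hX.measurable
  have : (fun θ => dataLaw μ X θ (cell q)) = fun θ =>
      (μ.prod (gaussianReal 0 1)) (Prod.mk θ ⁻¹' (observe X ⁻¹' cell q)) := by
    ext θ
    have hθ : Measurable fun w => observe X (θ, w) := hm.comp measurable_prodMk_left
    rw [dataLaw_eq_map_observe hX.measurable, Measure.map_apply hθ (measurableSet_cell q)]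
    rfl
  rw [this]
  exact measurable_measure_prodMk_left (hm (measurableSet_cell q))

theorem injOn_cellProb (hX : IsCovariateProcess μ X) : Set.InjOn (cellProb μ X) sortedParam := by
  intro θ hθ θ' hθ' h
  have := isProbabilityMeasure_dataLaw hX.measurable μ θ
  have := isProbabilityMeasure_dataLaw hX.measurable μ θ'
  exact hX.injOn_dataLaw hθ hθ' (measure_eq_of_cell fun q => congrFun h q)

theorem measurableSet_setOf_mem_sortedParam (p : ℕ+) :
    MeasurableSet {x : ParamOf p | (⟨p, x⟩ : Param) ∈ sortedParam} := by
  have : {x : ParamOf p | (⟨p, x⟩ : Param) ∈ sortedParam} =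
      (⋂ (i) (j) (_ : i < j), {x : ParamOf p | x.2.1 i < x.2.1 j}) ∩ ⋂ j, {x | x.1 j = 0}ᶜ := by
    ext x
    simp [sortedParam, StrictMono, ParamOf.time, ParamOf.coef]
  rw [this]
  refine MeasurableSet.inter (MeasurableSet.iInter fun i => MeasurableSet.iInter fun j =>
    MeasurableSet.iInter fun _ => measurableSet_lt (by fun_prop) (by fun_prop))
    (MeasurableSet.iInter fun j => (measurableSet_eq_fun (by fun_prop) (by fun_prop)).compl)

/-- The Lusin–Souslin theorem for the sorted parameters in a symmetrized Borel set. -/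
theorem measurableSet_image_cellProb (hX : IsCovariateProcess μ X) {p : ℕ+} {U : Set (ParamOf p)}
    (hU : MeasurableSet U) : MeasurableSet (cellProb μ X '' (symmetrize U ∩ sortedParam)) := by
  have : cellProb μ X '' (symmetrize U ∩ sortedParam) = (fun x => cellProb μ X ⟨p, x⟩) ''
      ({x : ParamOf p | ∃ ν, x.relabel ν ∈ U} ∩ {x | (⟨p, x⟩ : Param) ∈ sortedParam}) := by
    ext u
    constructor
    · rintro ⟨_, ⟨⟨x, hx, rfl⟩, hs⟩, rfl⟩
      exact ⟨x, ⟨hx, hs⟩, rfl⟩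
    · rintro ⟨x, ⟨hx, hs⟩, rfl⟩
      exact ⟨⟨p, x⟩, ⟨⟨x, hx, rfl⟩, hs⟩, rfl⟩
  rw [this]
  have hmk : Measurable (Sigma.mk p : ParamOf p → Param) := fun s hs =>
    MeasurableSpace.measurableSet_iInf.1 hs p
  refine ((measurableSet_setOf_relabel hU).inter
    (measurableSet_setOf_mem_sortedParam p)).image_of_measurable_injOn
    ((measurable_cellProb hX).comp hmk) ?_
  rintro x ⟨-, hx⟩ y ⟨-, hy⟩ h
  exact sigma_mk_injective (injOn_cellProb hX hx hy h)

/-- The data law determines whether an identifiable parameter lies in a symmetrized set. -/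
theorem cellProb_mem_image_iff (hX : IsCovariateProcess μ X) {p : ℕ+} {U : Set (ParamOf p)}
    {θ : Param} (ht : Function.Injective θ.2.time) (hc : ∀ j, θ.2.coef j ≠ 0) :
    cellProb μ X θ ∈ cellProb μ X '' (symmetrize U ∩ sortedParam) ↔ θ ∈ symmetrize U := by
  obtain ⟨q, y⟩ := θ
  obtain ⟨τ, hτ⟩ := exists_relabel_mem_sortedParam ht hc
  have hy : cellProb μ X ⟨q, y.relabel τ⟩ = cellProb μ X ⟨q, y⟩ := by
    ext r
    simp only [cellProb, dataLaw_relabel]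
  constructor
  · rintro ⟨θ', ⟨⟨x, ⟨ν, hν⟩, rfl⟩, hs⟩, h⟩
    rw [← hy] at h
    have heq := injOn_cellProb hX hs hτ h
    obtain rfl : p = q := congrArg Sigma.fst heq
    obtain rfl := sigma_mk_injective heq
    exact ⟨y, ⟨τ * ν, hν⟩, rfl⟩
  · rintro ⟨x, ⟨ν, hν⟩, hxy⟩
    obtain rfl : p = q := congrArg Sigma.fst hxy
    obtain rfl := sigma_mk_injective hxy
    refine ⟨_, ⟨⟨x.relabel τ, ⟨τ⁻¹ * ν, ?_⟩, rfl⟩, hτ⟩, hy⟩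
    rwa [relabel_relabel, mul_inv_cancel_left]

end Recovery

/-! ### The prior -/

section Prior

theorem isProbabilityMeasure_prior (π : PMF ℕ+)
    (F : ∀ p : ℕ+, Measure (Fin (p : ℕ) → ℝ)) [∀ p, IsProbabilityMeasure (F p)]
    (G : ∀ p : ℕ+, Measure (Fin (p : ℕ) → unitInterval)) [∀ p, IsProbabilityMeasure (G p)]
    (C : Measure ℝ) [IsProbabilityMeasure C] (D : Measure ℝ≥0) [IsProbabilityMeasure D] :
    IsProbabilityMeasure (prior π F G C D) := by
  have hmk : ∀ p : ℕ+, Measurable (Sigma.mk p : ParamOf p → Param) := fun p s hs =>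
    MeasurableSpace.measurableSet_iInf.1 hs p
  refine ⟨?_⟩
  rw [prior, Measure.sum_apply _ MeasurableSet.univ, ← π.tsum_coe]
  refine tsum_congr fun p => ?_
  rw [Measure.smul_apply, Measure.map_apply (hmk p) MeasurableSet.univ, Set.preimage_univ,
    measure_univ, smul_eq_mul, mul_one]

/-- Under the identifiability constraints almost every parameter has distinct times and non-zero
coefficients. -/
theorem Identifiability.ae {prr : Measure Param} [IsFiniteMeasure prr] (h : Identifiability prr) :
    ∀ᵐ θ ∂prr, Function.Injective θ.2.time ∧ ∀ j, θ.2.coef j ≠ 0 := by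
  have hcond : ∀ (p : ℕ+) (s : Set Param), cond prr (numComp p) s = 0 →
      ∀ᵐ θ ∂prr, θ.1 = p → θ ∉ s := by
    intro p s hs
    rw [cond_apply (measurableSet_numComp p), mul_eq_zero, ENNReal.inv_eq_zero] at hs
    have h0 := hs.resolve_left (measure_ne_top _ _)
    filter_upwards [measure_eq_zero_iff_ae_notMem.1 h0] with θ hθ hp hθs
    exact hθ ⟨hp, hθs⟩
  have h1 : ∀ p : ℕ+, ∀ i j : Fin (p : ℕ), ∀ᵐ θ ∂prr, i < j → θ.1 = p →
      θ ∉ {θ | ∃ x : ParamOf p, θ = ⟨p, x⟩ ∧ x.time i = x.time j} := by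
    intro p i j
    by_cases hij : i < j
    · filter_upwards [hcond p _ ((h p).1 i j hij)] with θ hθ _
      exact hθ
    · exact ae_of_all _ fun θ h' => absurd h' hij
  have h2 : ∀ p : ℕ+, ∀ j : Fin (p : ℕ), ∀ᵐ θ ∂prr, ∀ x : ParamOf p, θ = ⟨p, x⟩ →
      x.coef j ≠ 0 := by
    intro p j
    obtain ⟨δ, hδ, hj⟩ := (h p).2
    filter_upwards [hcond p _ (hj j)] with θ hθ x hx h0
    exact hθ (by rw [hx]) ⟨x, hx, by rwa [h0, abs_zero]⟩
  filter_upwards [ae_all_iff.2 fun p => ae_all_iff.2 fun i => ae_all_iff.2 (h1 p i),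
    ae_all_iff.2 fun p => ae_all_iff.2 (h2 p)] with θ hθ1 hθ2
  refine ⟨fun i j hij => ?_, fun j => hθ2 θ.1 j θ.2 rfl⟩
  by_contra hne
  rcases lt_or_gt_of_ne hne with hlt | hlt
  · exact hθ1 θ.1 i j hlt rfl ⟨θ.2, rfl, hij⟩
  · exact hθ1 θ.1 j i hlt rfl ⟨θ.2, rfl, hij.symm⟩

end Prior

/-! ### Posterior consistency -/

section Consistency

variable {Ω : Type*} [MeasurableSpace Ω] {μ : Measure Ω} [IsProbabilityMeasure μ]
  {X : unitInterval → Ω → ℝ}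

/-- Doob's theorem for the symmetrization of a Borel set. -/
theorem ae_tendsto_posterior_symmetrize (hX : IsCovariateProcess μ X) {prr : Measure Param}
    [IsProbabilityMeasure prr] (hident : Identifiability prr)
    {Q : ∀ n : ℕ, Kernel (Fin n → Obs) Param} (hQ : ∀ n, IsPosterior prr (dataLaw μ X) n (Q n))
    {p : ℕ+} {U : Set (ParamOf p)} (hU : MeasurableSet U) :
    ∀ᵐ θ ∂prr, θ ∈ symmetrize U → ∀ᵐ z ∂Measure.infinitePi (fun _ : ℕ => dataLaw μ X θ),
      Tendsto (fun n : ℕ => Q n (fun i : Fin n => z i) (symmetrize U)) atTop (𝓝 1) := by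
  refine ae_tendsto_posterior (measurable_observe hX.measurable)
    (dataLaw_eq_map_observe hX.measurable μ) hQ (measurableSet_symmetrize hU)
    (measurable_freq (measurableSet_image_cellProb hX hU)) ?_
  filter_upwards [hident.ae] with θ hθ
  have := isProbabilityMeasure_dataLaw hX.measurable μ θ
  filter_upwards [ae_freq_eq (dataLaw μ X θ)] with z hz
  rw [Set.mem_preimage, hz]
  exact cellProb_mem_image_iff hX hθ.1 hθ.2

/-- Transfer of the convergence from the sample space `ℕ → Obs` to an arbitrary i.i.d. sample, and
from a symmetrized basic open set to the permutation balls around `θ₀`. -/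
theorem ae_tendsto_posterior_permBall {prr : Measure Param} {P : Param → Measure Obs}
    {Q : ∀ n : ℕ, Kernel (Fin n → Obs) Param} (hQ : ∀ n, IsPosterior prr P n (Q n)) {θ₀ : Param}
    (hθ₀ : ∀ U ∈ TopologicalSpace.countableBasis (ParamOf θ₀.1), θ₀ ∈ symmetrize U →
      ∀ᵐ z ∂Measure.infinitePi (fun _ : ℕ => P θ₀),
        Tendsto (fun n : ℕ => Q n (fun i : Fin n => z i) (symmetrize U)) atTop (𝓝 1))
    {Ω' : Type*} [MeasurableSpace Ω'] {ρ : Measure Ω'} [IsProbabilityMeasure ρ] {Z : ℕ → Ω' → Obs}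
    (hZ : ∀ i, Measurable (Z i)) (hind : iIndepFun Z ρ) (hlaw : ∀ i, ρ.map (Z i) = P θ₀)
    {ε : ℝ} (hε : 0 < ε) : ∀ᵐ ω ∂ρ,
      Tendsto (fun n : ℕ => Q n (fun i : Fin n => Z i ω) (permBall θ₀ ε)) atTop (𝓝 1) := by
  have hmap : ρ.map (fun ω i => Z i ω) = Measure.infinitePi fun _ : ℕ => P θ₀ := by
    rw [(iIndepFun_iff_map_fun_eq_infinitePi_map hZ).1 hind]
    simp_rw [hlaw]
  obtain ⟨U, hU, hmem, hsub⟩ := exists_symmetrize_subset_permBall θ₀.2 hε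
  have h := hθ₀ U hU hmem
  rw [← hmap] at h
  filter_upwards [ae_of_ae_map (measurable_pi_lambda _ hZ).aemeasurable h] with ω hω
  have := fun n => (hQ n).1
  exact tendsto_of_tendsto_of_tendsto_of_le_of_le hω tendsto_const_nhds
    (fun n => measure_mono hsub) (fun n => prob_le_one)

end Consistency

end

end FunctionalRegression

theorem theorem2 {Ω : Type*} [MeasurableSpace Ω] (μ : Measure Ω) [IsProbabilityMeasure μ]
    (X : unitInterval → Ω → ℝ) (hX : FunctionalRegression.IsCovariateProcess μ X)
    (π : PMF ℕ+)
    (F : ∀ p : ℕ+, Measure (Fin (p : ℕ) → ℝ)) [∀ p, IsProbabilityMeasure (F p)]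
    (G : ∀ p : ℕ+, Measure (Fin (p : ℕ) → unitInterval)) [∀ p, IsProbabilityMeasure (G p)]
    (C : Measure ℝ) [IsProbabilityMeasure C] (D : Measure ℝ≥0) [IsProbabilityMeasure D]
    (hident : FunctionalRegression.Identifiability (FunctionalRegression.prior π F G C D))
    (Q : ∀ n : ℕ, Kernel (Fin n → FunctionalRegression.Obs) FunctionalRegression.Param)
    (hQ : ∀ n : ℕ, FunctionalRegression.IsPosterior (FunctionalRegression.prior π F G C D)
      (FunctionalRegression.dataLaw μ X) n (Q n)) :
    ∃ Θstar : Set FunctionalRegression.Param,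
      MeasurableSet Θstar ∧ FunctionalRegression.prior π F G C D Θstar = 1 ∧
      ∀ θ₀ ∈ Θstar,
        ∀ {Ω' : Type*} [MeasurableSpace Ω'] (ρ : Measure Ω') [IsProbabilityMeasure ρ]
          (Z : ℕ → Ω' → FunctionalRegression.Obs),
          (∀ i, Measurable (Z i)) → iIndepFun Z ρ →
          (∀ i, ρ.map (Z i) = FunctionalRegression.dataLaw μ X θ₀) →
          (∀ ε : ℝ, 0 < ε → ∀ᵐ ω ∂ρ,
            Tendsto (fun n : ℕ => Q n (fun i : Fin n => Z i ω)
              (FunctionalRegression.permBall θ₀ ε)) atTop (𝓝 1)) ∧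
          (∀ᵐ ω ∂ρ,
            Tendsto (fun n : ℕ => Q n (fun i : Fin n => Z i ω)
              (FunctionalRegression.numComp θ₀.1)) atTop (𝓝 1)) := by
  have := FunctionalRegression.isProbabilityMeasure_prior π F G C D
  have hall := ae_all_iff.2 fun p : ℕ+ =>
    (ae_ball_iff (TopologicalSpace.countable_countableBasis (FunctionalRegression.ParamOf p))).2
      fun U hU => FunctionalRegression.ae_tendsto_posterior_symmetrize hX hident hQ
        (TopologicalSpace.isOpen_of_mem_countableBasis hU).measurableSet
  obtain ⟨T, hT, hTm, hTall⟩ := hall.exists_measurable_mem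
  refine ⟨T, hTm, (mem_ae_iff_prob_eq_one hTm).1 hT, fun θ₀ hθ₀ => ?_⟩
  intro Ω' _ ρ _ Z hZ hind hlaw
  have hball := fun ε (hε : (0 : ℝ) < ε) => FunctionalRegression.ae_tendsto_posterior_permBall hQ
    (hTall θ₀ hθ₀ θ₀.1) hZ hind hlaw hε
  refine ⟨hball, ?_⟩
  filter_upwards [hball 1 one_pos] with ω hω
  have := fun n => (hQ n).1
  exact tendsto_of_tendsto_of_tendsto_of_le_of_le hω tendsto_const_nhds
    (fun n => measure_mono (FunctionalRegression.permBall_subset_numComp θ₀ le_rfl))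
    (fun n => prob_le_one)
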